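/- **Setting.** A planar network has $n$ sensors with unknown positions $x_1,\dots,x_n\in\mathbb R^2$ and $m\ge 1$ anchors with known positions $a_1,\dots,a_m\in\mathbb R^2$. Write $x=(x_1,\dots,x_n)\in\mathbb R^{2n}$. Let $\mathcal N_x$ be the set of sensor–sensor links and $\mathcal N_a$ the set of sensor–anchor links; the undirected graph formed by all sensors and anchors and these links is connected. On the links one has measurements $z_{ij}=\|x_i-x_j\|+\upsilon_{ij}$ and $z_{ik}=\|x_i-a_k\|+\upsilon_{ik}$ with $|\upsilon_{ij}|,|\upsilon_{ik}|\le\gamma$, where $\gamma$ is known. Put $\underline d=\max(z-\gamma,0)$ and $\overline d=z+\gamma$ on each link. The feasible set is $$\mathcal C=\{y\in\mathbb R^{2n}:\ \underline{d_{ij}}^2\le\|y_i-y_j\|^2\le\overline{d_{ij}}^2\ \ \forall (i,j)\in\mathcal N_x,\quad \underline{d_{ik}}^2\le\|y_i-a_k\|^2\le\overline{d_{ik}}^2\ \ \forall (i,k)\in\mathcal N_a\}.$$ **Relaxation.** Let $e_p$ be the standard basis of $\mathbb R^{2n}$ and $e_{(p)(q)}=e_p-e_q$. Put $$E_{ij}=e_{(2i-1)(2j-1)}e_{(2i-1)(2j-1)}^T+e_{(2i)(2j)}e_{(2i)(2j)}^T,\qquad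 E_i=e_{2i-1}e_{2i-1}^T+e_{2i}e_{2i}^T,$$ $$g_{ij}(\Delta)=\mathrm{Tr}(E_{ij}\Delta),\qquad g_{ik}(y,\Delta)=\|a_k\|^2-2a_k^Ty_i+\mathrm{Tr}(E_i\Delta).$$ Let $\mathcal G$ be the set of pairs $(y,\Delta)$ with $\underline{d_{ij}}^2\le g_{ij}(\Delta)\le\overline{d_{ij}}^2$ on $\mathcal N_x$, $\underline{d_{ik}}^2\le g_{ik}(y,\Delta)\le\overline{d_{ik}}^2$ on $\mathcal N_a$, and $\Delta=yy^T$. Let $\mathcal Q$ be the set defined in the same way with $\Delta\succeq yy^T$ in place of $\Delta=yy^T$. **Estimate.** For multipliers $\alpha_{ij},\beta_{ij},\omega_{ik},\varphi_{ik}$ put $f=\sum_{(i,k)\in\mathcal N_a}(\omega_{ik}-\varphi_{ik})(a_{kx}e_{2i-1}+a_{ky}e_{2i})$ and $$h=-\sum_{\mathcal N_x}\alpha_{ij}\underline{d_{ij}}^2+\sum_{\mathcal N_x}\beta_{ij}\overline{d_{ij}}^2+\sum_{\mathcal N_a}\omega_{ik}(\|a_k\|^2-\underline{d_{ik}}^2)+\sum_{\mathcal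 N_a}\varphi_{ik}(\overline{d_{ik}}^2-\|a_k\|^2).$$ Let $(\hat\alpha,\hat\beta,\hat\omega,\hat\varphi,\hat\lambda,\hat t)$ be any solution of the semidefinite program that minimizes $t+h$ subject to $\alpha_{ij},\beta_{ij},\omega_{ik},\varphi_{ik}\ge0$, $\lambda\succeq0$, $$I+\lambda=-\sum_{\mathcal N_x}(\alpha_{ij}-\beta_{ij})E_{ij}-\sum_{\mathcal N_a}(\omega_{ik}-\varphi_{ik})E_i,\qquad \begin{bmatrix}I+\lambda&f\\ f^T&t\end{bmatrix}\succeq0,$$ and let $x_{est}=-(I+\hat\lambda)^{-1}\hat f$, where $\hat f$ is $f$ evaluated at $\hat\omega,\hat\varphi$. **Claim.** All the maxima below and the minimum are attained (for every $\hat x\in\mathbb R^{2n}$ the maximum over $\mathcal Q$ is attained), and $$\|x_{est}-x\|^2\le\max_{y\in\mathcal C}\|x_{est}-y\|^2=\max_{(y,\Delta)\in\mathcal G}\mathrm{Tr}(\Delta-2x_{est}y^T+x_{est}x_{est}^T)$$ $$\le\max_{(y,\Delta)\in\mathcal Q}\mathrm{Tr}(\Delta-2x_{est}y^T+x_{est}x_{est}^T)=\min_{\hat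 x\in\mathbb R^{2n}}\max_{(y,\Delta)\in\mathcal Q}\mathrm{Tr}(\Delta-2\hat xy^T+\hat x\hat x^T).$$ Thus the squared localization error is bounded by the optimal value of the relaxed min–max problem. -/

import Mathlib

open Matrix

noncomputable section

namespace RangeLocalization

/-- Position vectors in `ℝ²ⁿ` with the Euclidean norm; the coordinate `(i, 0)` is the abscissa and
`(i, 1)` the ordinate of sensor `i`. -/
abbrev PosVec (n : ℕ) : Type := EuclideanSpace ℝ (Fin n × Fin 2)

/-- Real `2n × 2n` matrices. -/
abbrev PosMat (n : ℕ) : Type := Matrix (Fin n × Fin 2) (Fin n × Fin 2) ℝ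

/-- The known data of a planar localization problem with `n` sensors and `m` anchors. -/
structure Network (n m : ℕ) where
  /-- the sensor-sensor links -/
  Nx : Finset (Fin n × Fin n)
  /-- the sensor-anchor links -/
  Na : Finset (Fin n × Fin m)
  /-- a link joins two different sensors -/
  ne_of_mem : ∀ l ∈ Nx, l.1 ≠ l.2
  /-- the anchor positions -/
  anchor : Fin m → EuclideanSpace ℝ (Fin 2)
  /-- the sensor-sensor range measurements (only the values on `Nx` matter) -/
  zx : Fin n × Fin n → ℝ
  /-- the sensor-anchor range measurements (only the values on `Na` matter) -/
  za : Fin n × Fin m → ℝ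
  /-- the known bound on the measurement errors -/
  γ : ℝ

variable {n m : ℕ}

/-- The position of sensor `i` in the position vector `y`. -/
def sensorPos (y : PosVec n) (i : Fin n) : EuclideanSpace ℝ (Fin 2) :=
  !₂[y (i, 0), y (i, 1)]

namespace Network

/-- The relation "linked" between nodes (sensors on the left, anchors on the right). -/
def Linked (N : Network n m) : Fin n ⊕ Fin m → Fin n ⊕ Fin m → Prop
  | Sum.inl i, Sum.inl j => (i, j) ∈ N.Nx
  | Sum.inl i, Sum.inr k => (i, k) ∈ N.Na
  | Sum.inr _, _ => False

/-- The undirected measurement graph on all sensors and anchors. -/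
def graph (N : Network n m) : SimpleGraph (Fin n ⊕ Fin m) :=
  SimpleGraph.fromRel N.Linked

/-- `x` is a vector of true positions and `υx`, `υa` are errors bounded by `γ` that produce the
recorded measurements: `z = d + υ`, `|υ| ≤ γ`, on every link. -/
def Explains (N : Network n m) (x : PosVec n) (υx : Fin n × Fin n → ℝ) (υa : Fin n × Fin m → ℝ) :
    Prop :=
  (∀ l ∈ N.Nx, N.zx l = ‖sensorPos x l.1 - sensorPos x l.2‖ + υx l ∧ |υx l| ≤ N.γ) ∧
  (∀ l ∈ N.Na, N.za l = ‖sensorPos x l.1 - N.anchor l.2‖ + υa l ∧ |υa l| ≤ N.γ)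

/-- Lower distance bound of a sensor-sensor link; a negative bound is replaced by `0`. -/
def lowX (N : Network n m) (l : Fin n × Fin n) : ℝ := max (N.zx l - N.γ) 0

/-- Upper distance bound of a sensor-sensor link. -/
def upX (N : Network n m) (l : Fin n × Fin n) : ℝ := N.zx l + N.γ

/-- Lower distance bound of a sensor-anchor link; a negative bound is replaced by `0`. -/
def lowA (N : Network n m) (l : Fin n × Fin m) : ℝ := max (N.za l - N.γ) 0

/-- Upper distance bound of a sensor-anchor link. -/
def upA (N : Network n m) (l : Fin n × Fin m) : ℝ := N.za l + N.γ

/-- The set `C` of all feasible position vectors. -/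
def setC (N : Network n m) : Set (PosVec n) :=
  {y | (∀ l ∈ N.Nx, N.lowX l ^ 2 ≤ ‖sensorPos y l.1 - sensorPos y l.2‖ ^ 2 ∧
          ‖sensorPos y l.1 - sensorPos y l.2‖ ^ 2 ≤ N.upX l ^ 2) ∧
       (∀ l ∈ N.Na, N.lowA l ^ 2 ≤ ‖sensorPos y l.1 - N.anchor l.2‖ ^ 2 ∧
          ‖sensorPos y l.1 - N.anchor l.2‖ ^ 2 ≤ N.upA l ^ 2)}

end Network

/-- The standard basis vector of `ℝ²ⁿ` at coordinate `p`. -/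
def e (p : Fin n × Fin 2) : Fin n × Fin 2 → ℝ := Pi.single p 1

/-- The vector with `1` at coordinate `p` and `-1` at coordinate `q`. -/
def eDiff (p q : Fin n × Fin 2) : Fin n × Fin 2 → ℝ := e p - e q

/-- The matrix `y yᵀ`. -/
def outer (y : PosVec n) : PosMat n := vecMulVec y.ofLp y.ofLp

/-- `g_ij(Δ)`: the squared distance of sensors `i` and `j` with `y yᵀ` replaced by `Δ`. -/
def gX (l : Fin n × Fin n) (Δ : PosMat n) : ℝ :=
  eDiff (l.1, 0) (l.2, 0) ⬝ᵥ (Δ *ᵥ eDiff (l.1, 0) (l.2, 0)) +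
  eDiff (l.1, 1) (l.2, 1) ⬝ᵥ (Δ *ᵥ eDiff (l.1, 1) (l.2, 1))

/-- `Tr(Δ - 2 x̂ yᵀ + x̂ x̂ᵀ)`. -/
def objective (xhat : PosVec n) (p : PosVec n × PosMat n) : ℝ :=
  trace (p.2 - (2 : ℝ) • vecMulVec xhat.ofLp p.1.ofLp + outer xhat)

namespace Network

/-- `g_ik(y, Δ)`: the squared distance of sensor `i` and anchor `k` with `y yᵀ` replaced by `Δ`. -/
def gA (N : Network n m) (l : Fin n × Fin m) (y : PosVec n) (Δ : PosMat n) : ℝ :=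
  (N.anchor l.2).ofLp ⬝ᵥ (N.anchor l.2).ofLp
    - 2 * N.anchor l.2 0 * (y.ofLp ⬝ᵥ e (l.1, 0)) - 2 * N.anchor l.2 1 * (y.ofLp ⬝ᵥ e (l.1, 1))
    + e (l.1, 0) ⬝ᵥ (Δ *ᵥ e (l.1, 0)) + e (l.1, 1) ⬝ᵥ (Δ *ᵥ e (l.1, 1))

/-- The distance constraints, written in `(y, Δ)`. -/
def LiftedConstraints (N : Network n m) (y : PosVec n) (Δ : PosMat n) : Prop :=
  (∀ l ∈ N.Nx, N.lowX l ^ 2 ≤ gX l Δ ∧ gX l Δ ≤ N.upX l ^ 2) ∧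
  (∀ l ∈ N.Na, N.lowA l ^ 2 ≤ N.gA l y Δ ∧ N.gA l y Δ ≤ N.upA l ^ 2)

/-- The lifted constraint set `G`, with `Δ = y yᵀ`. -/
def setG (N : Network n m) : Set (PosVec n × PosMat n) :=
  {p | N.LiftedConstraints p.1 p.2 ∧ p.2 = outer p.1}

/-- The relaxed constraint set `Q`, with `Δ ⪰ y yᵀ`. -/
def setQ (N : Network n m) : Set (PosVec n × PosMat n) :=
  {p | N.LiftedConstraints p.1 p.2 ∧ (p.2 - outer p.1).PosSemidef}

end Network

/-- The matrix `E_ij`. -/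
def matX (l : Fin n × Fin n) : PosMat n :=
  vecMulVec (eDiff (l.1, 0) (l.2, 0)) (eDiff (l.1, 0) (l.2, 0)) +
  vecMulVec (eDiff (l.1, 1) (l.2, 1)) (eDiff (l.1, 1) (l.2, 1))

/-- The matrix `E_i`. -/
def matA (i : Fin n) : PosMat n :=
  vecMulVec (e (i, 0)) (e (i, 0)) + vecMulVec (e (i, 1)) (e (i, 1))

/-- The variables of the semidefinite program: the multipliers `α, β` of the sensor-sensor links,
`ω, φ` of the sensor-anchor links (only the values on links matter), the matrix multiplier `lam`
of `Δ - y yᵀ ⪰ 0`, and the scalar `t`. -/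
structure SDPVars (n m : ℕ) where
  α : Fin n × Fin n → ℝ
  β : Fin n × Fin n → ℝ
  ω : Fin n × Fin m → ℝ
  φ : Fin n × Fin m → ℝ
  lam : PosMat n
  t : ℝ

namespace Network

/-- The vector `f = ∑ (ω_ik - φ_ik) (a_kx e_{2i-1} + a_ky e_{2i})`. -/
def f (N : Network n m) (v : SDPVars n m) : Fin n × Fin 2 → ℝ :=
  ∑ l ∈ N.Na, (v.ω l - v.φ l) • (N.anchor l.2 0 • e (l.1, 0) + N.anchor l.2 1 • e (l.1, 1))

/-- The function `h(α, β, ω, φ)`. -/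
def h (N : Network n m) (v : SDPVars n m) : ℝ :=
  - ∑ l ∈ N.Nx, v.α l * N.lowX l ^ 2 + ∑ l ∈ N.Nx, v.β l * N.upX l ^ 2
  + ∑ l ∈ N.Na, v.ω l * ((N.anchor l.2).ofLp ⬝ᵥ (N.anchor l.2).ofLp - N.lowA l ^ 2)
  + ∑ l ∈ N.Na, v.φ l * (N.upA l ^ 2 - (N.anchor l.2).ofLp ⬝ᵥ (N.anchor l.2).ofLp)

/-- The constraints of the semidefinite program: nonnegative multipliers, `lam ⪰ 0`, stationarity of
the Lagrangian in `Δ` (which makes the dual function finite), and the Schur complement form of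
`fᵀ (I + lam)⁻¹ f ≤ t`. -/
def SDPFeasible (N : Network n m) (v : SDPVars n m) : Prop :=
  (∀ l ∈ N.Nx, 0 ≤ v.α l ∧ 0 ≤ v.β l) ∧
  (∀ l ∈ N.Na, 0 ≤ v.ω l ∧ 0 ≤ v.φ l) ∧
  v.lam.PosSemidef ∧
  1 + v.lam = - ∑ l ∈ N.Nx, (v.α l - v.β l) • matX l - ∑ l ∈ N.Na, (v.ω l - v.φ l) • matA l.1 ∧
  (fromBlocks (1 + v.lam) (replicateCol Unit (N.f v)) (replicateRow Unit (N.f v))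
    (of fun _ _ : Unit => v.t)).PosSemidef

/-- `v` solves the semidefinite program `min t + h(α, β, ω, φ)`. -/
def IsSDPSolution (N : Network n m) (v : SDPVars n m) : Prop :=
  N.SDPFeasible v ∧ ∀ w : SDPVars n m, N.SDPFeasible w → v.t + N.h v ≤ w.t + N.h w

/-- The relaxed estimate `x_est = -(I + lam)⁻¹ f`. -/
def xEst (N : Network n m) (v : SDPVars n m) : PosVec n :=
  WithLp.toLp 2 (-((1 + v.lam)⁻¹ *ᵥ N.f v))

/-- `max_{(y, Δ) ∈ Q} Tr(Δ - 2 x̂ yᵀ + x̂ x̂ᵀ)` (a supremum; that it is attained is to be shown where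
it is used). -/
def relaxedWorst (N : Network n m) (xhat : PosVec n) : ℝ := sSup (objective xhat '' N.setQ)

end Network

end RangeLocalization

end

namespace RangeLocalization

variable {n m : ℕ}

/-! The argument exhibits a saddle point. Completing the square gives `objective xhat (y, Δ) = Tr Δ
- ‖y‖² + ‖xhat - y‖²`, so `Tr Δ - ‖y‖²` bounds the objective from below for every `xhat`
(`objective_ge`). The semidefinite program is the Lagrange dual of maximizing this concave function
over `Q`. Weak duality, sharpened by the choice of `xEst`, bounds the whole objective at `xEst` by
`t + h` on `Q` (`mem_setQ_objective_le`). Strong duality provides a point of `Q` with `Tr Δ - ‖y‖² ≥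
t + h` (`exists_mem_setQ_value_le`). Together these make `xEst` a minimizer of the relaxed worst
case.

Strong duality needs no interior point of `Q`: joint superlevel sets of the value and the
constraints are compact, so the set of values to be separated is closed and Hahn–Banach separates
strictly. The compactness comes from connectedness: bounds on the diagonal of `Δ` spread from an
anchor along the links. The statements about `C` and `G` rest on `Δ = y yᵀ` turning the objective
into `‖xhat - y‖²`. -/

/-! ### Trace identities and the Lagrangian. -/

open scoped MatrixOrder Matrix.Norms.L2Operator in
/-- The trace of a product of two positive semidefinite matrices is nonnegative. -/
theorem trace_mul_nonneg_of_posSemidef {κ : Type*} [Fintype κ] {A B : Matrix κ κ ℝ}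
    (hA : A.PosSemidef) (hB : B.PosSemidef) : 0 ≤ trace (A * B) := by
  classical
  obtain ⟨C, rfl⟩ := (CStarAlgebra.nonneg_iff_eq_star_mul_self (a := A)).mp hA.nonneg
  rw [star_eq_conjTranspose, Matrix.mul_assoc, trace_mul_comm]
  exact (hB.mul_mul_conjTranspose_same C).trace_nonneg

theorem trace_vecMulVec_mul {κ : Type*} [Fintype κ] (a : κ → ℝ) (B : Matrix κ κ ℝ) :
    trace (vecMulVec a a * B) = a ⬝ᵥ B *ᵥ a := by
  rw [vecMulVec_mul, trace_vecMulVec, dotProduct_mulVec, dotProduct_comm]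

theorem dotProduct_vecMulVec_mulVec {κ : Type*} [Fintype κ] (a z : κ → ℝ) :
    z ⬝ᵥ vecMulVec a a *ᵥ z = (z ⬝ᵥ a) ^ 2 := by
  rw [vecMulVec_mulVec, dotProduct_comm a z]
  simp [dotProduct_smul, sq]

theorem dotProduct_mulVec_comm {κ : Type*} [Fintype κ] {A : Matrix κ κ ℝ} (hA : A.IsHermitian)
    (a b : κ → ℝ) : a ⬝ᵥ A *ᵥ b = b ⬝ᵥ A *ᵥ a := by
  rw [dotProduct_mulVec, ← mulVec_transpose, dotProduct_comm]
  congr 2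

theorem gX_eq_trace (l : Fin n × Fin n) (Δ : PosMat n) : gX l Δ = trace (matX l * Δ) := by
  simp [gX, matX, Matrix.add_mul, trace_vecMulVec_mul]

theorem gX_eq_entries (l : Fin n × Fin n) (Δ : PosMat n) :
    gX l Δ = Δ (l.1, 0) (l.1, 0) - Δ (l.1, 0) (l.2, 0) - Δ (l.2, 0) (l.1, 0)
      + Δ (l.2, 0) (l.2, 0) + (Δ (l.1, 1) (l.1, 1) - Δ (l.1, 1) (l.2, 1) - Δ (l.2, 1) (l.1, 1)
      + Δ (l.2, 1) (l.2, 1)) := by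
  simp [gX, eDiff, e, mulVec_sub, sub_dotProduct]
  ring

theorem gA_eq_entries (N : Network n m) (l : Fin n × Fin m) (y : PosVec n) (Δ : PosMat n) :
    N.gA l y Δ = (N.anchor l.2 0 ^ 2 + N.anchor l.2 1 ^ 2) - 2 * N.anchor l.2 0 * y (l.1, 0)
      - 2 * N.anchor l.2 1 * y (l.1, 1) + Δ (l.1, 0) (l.1, 0) + Δ (l.1, 1) (l.1, 1) := by
  simp [Network.gA, e]
  simp [sq]

theorem gA_eq_trace (N : Network n m) (l : Fin n × Fin m) (y : PosVec n) (Δ : PosMat n) :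
    N.gA l y Δ = (N.anchor l.2).ofLp ⬝ᵥ (N.anchor l.2).ofLp
      - 2 * ((N.anchor l.2 0 • e (l.1, 0) + N.anchor l.2 1 • e (l.1, 1)) ⬝ᵥ y.ofLp)
      + trace (matA l.1 * Δ) := by
  simp only [Network.gA, matA, Matrix.add_mul, trace_add, trace_vecMulVec_mul, add_dotProduct,
    smul_dotProduct, smul_eq_mul, dotProduct_comm y.ofLp]
  ring

/-- The sum of the distance constraints, weighted by the multipliers. -/
def Network.weightedSlack (N : Network n m) (v : SDPVars n m) (y : PosVec n) (Δ : PosMat n) : ℝ :=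
  ∑ l ∈ N.Nx, v.α l * (gX l Δ - N.lowX l ^ 2) + ∑ l ∈ N.Nx, v.β l * (N.upX l ^ 2 - gX l Δ)
  + ∑ l ∈ N.Na, v.ω l * (N.gA l y Δ - N.lowA l ^ 2)
  + ∑ l ∈ N.Na, v.φ l * (N.upA l ^ 2 - N.gA l y Δ)

/-- The matrix that multiplies `-Δ` in the Lagrangian. -/
def Network.lagrangeMat (N : Network n m) (v : SDPVars n m) : PosMat n :=
  - ∑ l ∈ N.Nx, (v.α l - v.β l) • matX l - ∑ l ∈ N.Na, (v.ω l - v.φ l) • matA l.1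

/-- All constraints are affine in `(y, Δ)`; collecting coefficients yields exactly the data `h`, `f`
and the stationarity matrix of the semidefinite program. -/
theorem weightedSlack_eq (N : Network n m) (v : SDPVars n m) (y : PosVec n) (Δ : PosMat n) :
    N.weightedSlack v y Δ = N.h v - trace (N.lagrangeMat v * Δ) - 2 * (N.f v ⬝ᵥ y.ofLp) := by
  have hL : trace (N.lagrangeMat v * Δ) = - ∑ l ∈ N.Nx, (v.α l - v.β l) * gX l Δ
      - ∑ l ∈ N.Na, (v.ω l - v.φ l) * trace (matA l.1 * Δ) := by
    simp only [Network.lagrangeMat, Matrix.sub_mul, Matrix.neg_mul, Matrix.sum_mul, trace_sub,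
      trace_neg, trace_sum, Matrix.smul_mul, trace_smul, smul_eq_mul, gX_eq_trace]
  have hf : N.f v ⬝ᵥ y.ofLp = ∑ l ∈ N.Na, (v.ω l - v.φ l) *
      ((N.anchor l.2 0 • e (l.1, 0) + N.anchor l.2 1 • e (l.1, 1)) ⬝ᵥ y.ofLp) := by
    simp only [Network.f, sum_dotProduct, smul_dotProduct, smul_eq_mul]
  have h1 : ∑ l ∈ N.Nx, v.α l * (gX l Δ - N.lowX l ^ 2)
      + ∑ l ∈ N.Nx, v.β l * (N.upX l ^ 2 - gX l Δ)
      = - ∑ l ∈ N.Nx, v.α l * N.lowX l ^ 2 + ∑ l ∈ N.Nx, v.β l * N.upX l ^ 2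
        + ∑ l ∈ N.Nx, (v.α l - v.β l) * gX l Δ := by
    simp only [← Finset.sum_neg_distrib, ← Finset.sum_add_distrib]
    exact Finset.sum_congr rfl fun l _ => by ring
  have h2 : ∑ l ∈ N.Na, v.ω l * (N.gA l y Δ - N.lowA l ^ 2)
      + ∑ l ∈ N.Na, v.φ l * (N.upA l ^ 2 - N.gA l y Δ)
      = ∑ l ∈ N.Na, v.ω l * ((N.anchor l.2).ofLp ⬝ᵥ (N.anchor l.2).ofLp - N.lowA l ^ 2)
        + ∑ l ∈ N.Na, v.φ l * (N.upA l ^ 2 - (N.anchor l.2).ofLp ⬝ᵥ (N.anchor l.2).ofLp)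
        + ∑ l ∈ N.Na, (v.ω l - v.φ l) * trace (matA l.1 * Δ)
        - 2 * ∑ l ∈ N.Na, (v.ω l - v.φ l) *
          ((N.anchor l.2 0 • e (l.1, 0) + N.anchor l.2 1 • e (l.1, 1)) ⬝ᵥ y.ofLp) := by
    simp only [Finset.mul_sum, ← Finset.sum_sub_distrib, ← Finset.sum_add_distrib]
    exact Finset.sum_congr rfl fun l _ => by rw [gA_eq_trace]; ring
  rw [hL, hf, Network.weightedSlack, Network.h]
  linarith

theorem weightedSlack_nonneg {N : Network n m} {v : SDPVars n m}
    (hx : ∀ l ∈ N.Nx, 0 ≤ v.α l ∧ 0 ≤ v.β l) (ha : ∀ l ∈ N.Na, 0 ≤ v.ω l ∧ 0 ≤ v.φ l)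
    {y : PosVec n} {Δ : PosMat n} (h : N.LiftedConstraints y Δ) : 0 ≤ N.weightedSlack v y Δ := by
  unfold Network.weightedSlack
  refine add_nonneg (add_nonneg (add_nonneg ?_ ?_) ?_) ?_ <;>
    refine Finset.sum_nonneg fun l hl => mul_nonneg ?_ (sub_nonneg.mpr ?_)
  exacts [(hx l hl).1, (h.1 l hl).1, (hx l hl).2, (h.1 l hl).2, (ha l hl).1, (h.2 l hl).1,
    (ha l hl).2, (h.2 l hl).2]

theorem objective_eq (xhat y : PosVec n) (Δ : PosMat n) :
    objective xhat (y, Δ)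
      = trace Δ - 2 * (xhat.ofLp ⬝ᵥ y.ofLp) + xhat.ofLp ⬝ᵥ xhat.ofLp := by
  simp [objective, outer, trace_vecMulVec]

theorem dotProduct_self_eq_norm_sq (y : PosVec n) : y.ofLp ⬝ᵥ y.ofLp = ‖y‖ ^ 2 := by
  rw [EuclideanSpace.real_norm_sq_eq, dotProduct]
  exact Finset.sum_congr rfl fun i _ => (sq _).symm

theorem objective_outer (xhat y : PosVec n) : objective xhat (y, outer y) = ‖xhat - y‖ ^ 2 := by
  rw [objective_eq, ← dotProduct_self_eq_norm_sq, WithLp.ofLp_sub, outer, trace_vecMulVec,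
    sub_dotProduct, dotProduct_sub, dotProduct_sub, dotProduct_comm y.ofLp xhat.ofLp]
  ring

/-- The difference of the two sides is `‖xhat - y‖²`. -/
theorem objective_ge (xhat y : PosVec n) (Δ : PosMat n) :
    trace Δ - y.ofLp ⬝ᵥ y.ofLp ≤ objective xhat (y, Δ) := by
  have h := objective_outer xhat y
  rw [objective_eq, outer, trace_vecMulVec] at h
  rw [objective_eq]
  nlinarith [sq_nonneg ‖xhat - y‖]

/-! ### Schur blocks and weak duality. -/

theorem quadratic_nonneg_of_fromBlocks {κ : Type*} [Fintype κ] {A : Matrix κ κ ℝ} {b : κ → ℝ}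
    {t : ℝ} (h : (fromBlocks A (replicateCol Unit b) (replicateRow Unit b)
      (of fun _ _ : Unit => t)).PosSemidef) (z : κ → ℝ) :
    0 ≤ z ⬝ᵥ A *ᵥ z + 2 * (b ⬝ᵥ z) + t := by
  have := h.dotProduct_mulVec_nonneg (Sum.elim z fun _ => 1)
  simp [dotProduct, mulVec, Finset.sum_add_distrib, mul_add] at this
  simp [dotProduct, mulVec, two_mul]
  simp only [mul_comm (z _) (b _)] at this
  linarith

/-- Homogenization: the form at `(z, c)` is `c²` times the inhomogeneous quadratic at `z / c`;
positivity of `A` covers `c = 0`. -/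
theorem fromBlocks_posSemidef {κ : Type*} [Fintype κ] {A : Matrix κ κ ℝ} (hA : A.PosSemidef)
    {b : κ → ℝ} {t : ℝ} (h : ∀ z, 0 ≤ z ⬝ᵥ A *ᵥ z + 2 * (b ⬝ᵥ z) + t) :
    (fromBlocks A (replicateCol Unit b) (replicateRow Unit b)
      (of fun _ _ : Unit => t)).PosSemidef := by
  refine PosSemidef.of_dotProduct_mulVec_nonneg ?_ fun w => ?_
  · refine IsHermitian.fromBlocks hA.1 ?_ ?_
    · ext; simp
    · ext; simp
  · have key : star w ⬝ᵥ fromBlocks A (replicateCol Unit b) (replicateRow Unit b)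
        (of fun _ _ : Unit => t) *ᵥ w = (w ∘ Sum.inl) ⬝ᵥ A *ᵥ (w ∘ Sum.inl)
          + 2 * w (Sum.inr ()) * (b ⬝ᵥ (w ∘ Sum.inl)) + t * w (Sum.inr ()) ^ 2 := by
      simp [dotProduct, mulVec, Finset.sum_add_distrib, mul_add, two_mul,
        add_mul, Finset.mul_sum]
      simp only [mul_left_comm (w (Sum.inr ())), mul_comm (w (Sum.inr ())), mul_left_comm (w _) (b _)]
      ring
    rw [key]
    set c := w (Sum.inr ())
    set z := w ∘ Sum.inl
    rcases eq_or_ne c 0 with hc | hc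
    · simpa [hc] using hA.dotProduct_mulVec_nonneg z
    · have := mul_nonneg (sq_nonneg c) (h (c⁻¹ • z))
      simp only [mulVec_smul, dotProduct_smul, smul_dotProduct, smul_eq_mul] at this
      convert this using 1
      field_simp

/-- Optimality of `v` plays no role. With `u = xEst` and `f = -(I + lam) u`, the Schur block at `u`
gives `t ≥ uᵀ(I + lam)u`. Adding the nonnegative slack and `Tr(lam (Δ - y yᵀ)) ≥ 0` leaves the
objective plus `(y - u)ᵀ lam (y - u) ≥ 0`. -/
theorem mem_setQ_objective_le {N : Network n m} {v : SDPVars n m} (hv : N.SDPFeasible v)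
    {p : PosVec n × PosMat n} (hp : p ∈ N.setQ) :
    objective (N.xEst v) p ≤ v.t + N.h v := by
  obtain ⟨y, Δ⟩ := p
  obtain ⟨hx, ha, hlam, hL, hblk⟩ := hv
  obtain ⟨hc, hΔ⟩ := hp
  have hA : (1 + v.lam).PosDef := PosDef.one.add_posSemidef hlam
  have hf : N.f v = -((1 + v.lam) *ᵥ (N.xEst v).ofLp) := by
    have : IsUnit (1 + v.lam).det := (isUnit_iff_isUnit_det _).mp hA.isUnit
    simp [Network.xEst, mulVec_neg, mulVec_mulVec, mul_nonsing_inv _ this]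
  have h1 := weightedSlack_nonneg hx ha hc
  rw [weightedSlack_eq, show N.lagrangeMat v = 1 + v.lam from hL.symm, Matrix.add_mul, trace_add,
    Matrix.one_mul] at h1
  have h2 := trace_mul_nonneg_of_posSemidef hlam hΔ
  rw [Matrix.mul_sub, trace_sub, trace_mul_comm v.lam (outer y), outer, trace_vecMulVec_mul] at h2
  have h3 := quadratic_nonneg_of_fromBlocks hblk (N.xEst v).ofLp
  have h4 := hlam.dotProduct_mulVec_nonneg (y.ofLp - (N.xEst v).ofLp)
  simp only [star_trivial, mulVec_sub, sub_dotProduct, dotProduct_sub] at h4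
  rw [dotProduct_mulVec_comm hlam.1 (N.xEst v).ofLp y.ofLp] at h4
  rw [objective_eq]
  generalize (N.xEst v).ofLp = u at *
  rw [hf] at h1 h3
  simp only [neg_dotProduct, add_mulVec, one_mulVec, add_dotProduct, dotProduct_add,
    dotProduct_comm (v.lam *ᵥ _) _] at h1 h3
  linarith

/-! ### Separation for concave functions. -/

/-- A theorem of the alternative for finitely many concave functions whose joint superlevel sets are
compact. -/
theorem exists_weights_of_forall_exists_neg {E ι : Type*} [AddCommGroup E] [Module ℝ E]
    [TopologicalSpace E] [T2Space E] [Fintype ι] {D : Set E} {F : ι → E → ℝ}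
    (hF : ∀ i, ConcaveOn ℝ D (F i)) (hD : Convex ℝ D)
    (hK : ∀ c : ι → ℝ, IsCompact {x | x ∈ D ∧ ∀ i, c i ≤ F i x})
    (hneg : ∀ x ∈ D, ∃ i, F i x < 0) :
    ∃ μ : ι → ℝ, (∀ i, 0 ≤ μ i) ∧ ∃ δ > 0, ∀ x ∈ D, ∑ i, μ i * F i x ≤ -δ := by
  classical
  rcases D.eq_empty_or_nonempty with rfl | ⟨x₀, hx₀⟩
  · exact ⟨0, by simp, 1, one_pos, by simp⟩
  set T : Set (ι → ℝ) := {u | ∃ x ∈ D, ∀ i, u i ≤ F i x}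
  have hconv : Convex ℝ T := by
    rintro u ⟨x, hx, hux⟩ w ⟨y, hy, hwy⟩ a b ha hb hab
    refine ⟨a • x + b • y, hD hx hy ha hb hab, fun i => ?_⟩
    refine le_trans ?_ ((hF i).2 hx hy ha hb hab)
    exact add_le_add (mul_le_mul_of_nonneg_left (hux i) ha) (mul_le_mul_of_nonneg_left (hwy i) hb)
  have hclosed : IsClosed T := by
    refine isClosed_of_closure_subset fun u hu => ?_
    -- A limit `u` of points of `T` is dominated up to `1/(k+1)` on a nonempty compact set for each
    -- `k`; these sets decrease, so a common point dominates `u` itself.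
    have hne : (⋂ k : ℕ, {x | x ∈ D ∧ ∀ i, (u i - 1 / ((k : ℝ) + 1)) ≤ F i x}).Nonempty := by
      refine IsCompact.nonempty_iInter_of_sequence_nonempty_isCompact_isClosed _ (fun k x hx => ?_)
        (fun k => ?_) (hK _) (fun k => (hK _).isClosed)
      · refine ⟨hx.1, fun i => le_trans ?_ (hx.2 i)⟩
        have : 1 / (((k + 1 : ℕ) : ℝ) + 1) ≤ 1 / ((k : ℝ) + 1) := by
          apply one_div_le_one_div_of_le
          · positivity
          · push_cast; linarith
        linarith
      · have hε : 0 < 1 / ((k : ℝ) + 1) := by positivity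
        obtain ⟨w, ⟨x, hx, hwx⟩, hw⟩ := Metric.mem_closure_iff.mp hu _ hε
        refine ⟨x, hx, fun i => le_trans ?_ (hwx i)⟩
        have := (dist_le_pi_dist u w i).trans_lt hw
        rw [Real.dist_eq] at this
        linarith [(abs_lt.mp this).2]
    obtain ⟨x, hx⟩ := hne
    rw [Set.mem_iInter] at hx
    refine ⟨x, (hx 0).1, fun i => ?_⟩
    have ht : Filter.Tendsto (fun k : ℕ => u i - 1 / ((k : ℝ) + 1)) Filter.atTop (nhds (u i)) := by
      simpa using (tendsto_const_nhds (x := u i)).sub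
        (tendsto_one_div_add_atTop_nhds_zero_nat (𝕜 := ℝ))
    exact le_of_tendsto' ht fun k => (hx k).2 i
  have h0 : (0 : ι → ℝ) ∉ T := by
    rintro ⟨x, hx, h⟩
    obtain ⟨i, hi⟩ := hneg x hx
    exact absurd (h i) (not_le.mpr hi)
  obtain ⟨f, s, hfs, hs⟩ := geometric_hahn_banach_closed_point hconv hclosed h0
  rw [map_zero] at hs
  have hrep : ∀ u : ι → ℝ, f u = ∑ i, f (Pi.single i 1) * u i := by
    intro u
    conv_lhs => rw [pi_eq_sum_univ' u, map_sum]
    refine Finset.sum_congr rfl fun i _ => ?_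
    rw [map_smul, smul_eq_mul, mul_comm]
  refine ⟨fun i => f (Pi.single i 1), fun i => ?_, -s, by linarith, fun x hx => ?_⟩
  -- `T` is closed under decreasing coordinates. If the weight `a` were negative, lowering
  -- coordinate `i` by `|b| / (-a)` would raise `f` to `b + |b| ≥ 0`, above the separating level `s
  -- < 0`.
  · by_contra! hi
    set a := f (Pi.single i 1)
    set b := f fun j => F j x₀
    have hK0 : 0 ≤ |b| / (-a) := div_nonneg (abs_nonneg _) (by linarith)
    have hmem : (fun j => F j x₀) - (|b| / (-a)) • Pi.single i (1 : ℝ) ∈ T := by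
      refine ⟨x₀, hx₀, fun j => ?_⟩
      rcases eq_or_ne j i with rfl | hj
      · simpa using hK0
      · simp [hj]
    have := hfs _ hmem
    rw [map_sub, map_smul, smul_eq_mul] at this
    have h2 : |b| / (-a) * a = -|b| := by rw [div_neg, neg_mul, div_mul_cancel₀ _ hi.ne]
    change b - |b| / (-a) * a < s at this
    rw [h2] at this
    linarith [neg_abs_le b]
  · have := hfs (fun i => F i x) ⟨x, hx, fun i => le_rfl⟩
    rw [hrep] at this
    linarith

/-! ### The convex domain `Δ ⪰ y yᵀ`. -/

/-- The set of all pairs `(y, Δ)` with `Δ ⪰ y yᵀ`. -/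
def liftedDomain (n : ℕ) : Set (PosVec n × PosMat n) := {p | (p.2 - outer p.1).PosSemidef}

theorem outer_isHermitian (y : PosVec n) : (outer y).IsHermitian := by
  ext i j
  simp [outer, vecMulVec_apply, mul_comm]

/-- Testing against each `z` separately makes convexity (the square is convex) and closedness
visible. -/
theorem mem_liftedDomain_iff {p : PosVec n × PosMat n} :
    p ∈ liftedDomain n ↔ p.2.IsHermitian ∧ ∀ z, (z ⬝ᵥ p.1.ofLp) ^ 2 ≤ z ⬝ᵥ p.2 *ᵥ z := by
  have hz : ∀ z, star z ⬝ᵥ (p.2 - outer p.1) *ᵥ z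
      = z ⬝ᵥ p.2 *ᵥ z - (z ⬝ᵥ p.1.ofLp) ^ 2 := fun z => by
    rw [star_trivial, sub_mulVec, dotProduct_sub, outer, dotProduct_vecMulVec_mulVec]
  constructor
  · intro h
    refine ⟨by simpa using h.1.add (outer_isHermitian p.1), fun z => ?_⟩
    linarith [h.dotProduct_mulVec_nonneg z, hz z]
  · rintro ⟨h1, h2⟩
    refine PosSemidef.of_dotProduct_mulVec_nonneg (h1.sub (outer_isHermitian p.1)) fun z => ?_
    linarith [h2 z, hz z]

theorem outer_mem_liftedDomain (y : PosVec n) : (y, outer y) ∈ liftedDomain n := by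
  simpa [liftedDomain] using PosSemidef.zero

theorem convex_liftedDomain : Convex ℝ (liftedDomain n) := by
  intro p hp q hq a b ha hb hab
  rw [mem_liftedDomain_iff] at *
  refine ⟨?_, fun z => ?_⟩
  · have h1 := hp.1.eq
    have h2 := hq.1.eq
    simp only [conjTranspose_eq_transpose_of_trivial] at h1 h2
    simp [IsHermitian, h1, h2]
  · have h1 := mul_le_mul_of_nonneg_left (hp.2 z) ha
    have h2 := mul_le_mul_of_nonneg_left (hq.2 z) hb
    simp only [Prod.fst_add, Prod.snd_add, Prod.smul_fst, Prod.smul_snd, WithLp.ofLp_add,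
      WithLp.ofLp_smul, dotProduct_add, dotProduct_smul, add_mulVec, smul_mulVec, smul_eq_mul]
    obtain rfl : b = 1 - a := by linarith
    nlinarith [mul_nonneg (mul_nonneg ha hb) (sq_nonneg (z ⬝ᵥ p.1.ofLp - z ⬝ᵥ q.1.ofLp))]

theorem isClosed_liftedDomain : IsClosed (liftedDomain n) := by
  have : liftedDomain n = {p | p.2ᴴ = p.2} ∩
      ⋂ z : Fin n × Fin 2 → ℝ, {p | (z ⬝ᵥ p.1.ofLp) ^ 2 ≤ z ⬝ᵥ p.2 *ᵥ z} := by
    ext p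
    simp [mem_liftedDomain_iff, IsHermitian]
  rw [this]
  refine (isClosed_eq (by fun_prop) (by fun_prop)).inter
    (isClosed_iInter fun z => isClosed_le ?_ ?_) <;> fun_prop

section entries

variable {p : PosVec n × PosMat n} (hp : p ∈ liftedDomain n)
include hp

theorem entry_symm (i j : Fin n × Fin 2) : p.2 i j = p.2 j i := by
  simpa using (mem_liftedDomain_iff.mp hp).1.apply j i

theorem sq_le_diag (i : Fin n × Fin 2) : p.1 i ^ 2 ≤ p.2 i i := by
  simpa [e] using (mem_liftedDomain_iff.mp hp).2 (e i)

theorem quadratic_entries_nonneg (a b : ℝ) (i j : Fin n × Fin 2) :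
    0 ≤ a ^ 2 * p.2 i i + 2 * a * b * p.2 i j + b ^ 2 * p.2 j j := by
  have h := (mem_liftedDomain_iff.mp hp).2 (a • e i + b • e j)
  have h2 := (sq_nonneg _).trans h
  simp [e, mulVec_add, mulVec_smul] at h2
  rw [entry_symm hp j i] at h2
  linarith

/-- The lifted form of `‖y_i‖² ≤ 2‖y_j‖² + 2‖y_i - y_j‖²`; the test vectors `-e_i + 2e_j` and `2e_i
- e_j` give exactly the differences of the two sides. -/
theorem diag_le_of_gX (l : Fin n × Fin n) :
    p.2 (l.1, 0) (l.1, 0) + p.2 (l.1, 1) (l.1, 1)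
      ≤ 2 * (p.2 (l.2, 0) (l.2, 0) + p.2 (l.2, 1) (l.2, 1)) + 2 * gX l p.2 ∧
    p.2 (l.2, 0) (l.2, 0) + p.2 (l.2, 1) (l.2, 1)
      ≤ 2 * (p.2 (l.1, 0) (l.1, 0) + p.2 (l.1, 1) (l.1, 1)) + 2 * gX l p.2 := by
  rw [gX_eq_entries, entry_symm hp (l.2, 0) (l.1, 0), entry_symm hp (l.2, 1) (l.1, 1)]
  constructor
  · linarith [quadratic_entries_nonneg hp (-1) 2 (l.1, 0) (l.2, 0),
      quadratic_entries_nonneg hp (-1) 2 (l.1, 1) (l.2, 1)]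
  · linarith [quadratic_entries_nonneg hp 2 (-1) (l.1, 0) (l.2, 0),
      quadratic_entries_nonneg hp 2 (-1) (l.1, 1) (l.2, 1)]

theorem diag_le_of_gA (N : Network n m) (l : Fin n × Fin m) :
    p.2 (l.1, 0) (l.1, 0) + p.2 (l.1, 1) (l.1, 1)
      ≤ 2 * (N.anchor l.2 0 ^ 2 + N.anchor l.2 1 ^ 2) + 2 * N.gA l p.1 p.2 := by
  rw [gA_eq_entries]
  nlinarith [sq_le_diag hp (l.1, 0), sq_le_diag hp (l.1, 1),
    sq_nonneg (p.1 (l.1, 0) - 2 * N.anchor l.2 0), sq_nonneg (p.1 (l.1, 1) - 2 * N.anchor l.2 1)]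

end entries

/-! ### Compactness from connectedness. -/

/-- The pairs `(y, Δ)` with `Δ ⪰ y yᵀ` that obey given upper bounds on all links. -/
def Network.upperSet (N : Network n m) (cX : Fin n × Fin n → ℝ) (cA : Fin n × Fin m → ℝ) :
    Set (PosVec n × PosMat n) :=
  {p | p ∈ liftedDomain n ∧ (∀ l ∈ N.Nx, gX l p.2 ≤ cX l) ∧ ∀ l ∈ N.Na, N.gA l p.1 p.2 ≤ cA l}

/-- In a connected network with an anchor, upper distance bounds bound every diagonal block. -/
theorem exists_diag_bound (N : Network n m) (hm : 0 < m) (hconn : N.graph.Connected)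
    (cX : Fin n × Fin n → ℝ) (cA : Fin n × Fin m → ℝ) (i : Fin n) :
    ∃ B : ℝ, ∀ p ∈ N.upperSet cX cA, p.2 (i, 0) (i, 0) + p.2 (i, 1) (i, 1) ≤ B := by
  -- `P` is vacuous at anchors, so it can start a walk there; a step from an anchor to a sensor uses
  -- only the anchor constraint.
  let P : Fin n ⊕ Fin m → Prop := fun s => ∀ i, s = Sum.inl i →
    ∃ B : ℝ, ∀ p ∈ N.upperSet cX cA, p.2 (i, 0) (i, 0) + p.2 (i, 1) (i, 1) ≤ B
  have hA : ∀ i k, (i, k) ∈ N.Na → P (Sum.inl i) := by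
    rintro i k hik j hj
    obtain rfl := Sum.inl_injective hj
    exact ⟨2 * (N.anchor k 0 ^ 2 + N.anchor k 1 ^ 2) + 2 * cA (i, k), fun p hp =>
      (diag_le_of_gA hp.1 N (i, k)).trans (by have := hp.2.2 _ hik; simp only; linarith)⟩
  have hstep : ∀ s t, N.graph.Adj s t → P s → P t := by
    rintro s t hst hs
    rw [Network.graph, SimpleGraph.fromRel_adj] at hst
    rcases s with i | k <;> rcases t with j | k'
    · rintro j' hj
      obtain rfl := Sum.inl_injective hj
      obtain ⟨B, hB⟩ := hs i rfl
      rcases hst.2 with h | h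
      · exact ⟨2 * B + 2 * cX (i, j), fun p hp => (diag_le_of_gX hp.1 (i, j)).2.trans (by
          have := hp.2.1 _ h; have := hB p hp; simp only; linarith)⟩
      · exact ⟨2 * B + 2 * cX (j, i), fun p hp => (diag_le_of_gX hp.1 (j, i)).1.trans (by
          have := hp.2.1 _ h; have := hB p hp; simp only; linarith)⟩
    · rintro j' hj
      cases hj
    · rcases hst.2 with h | h
      · exact h.elim
      · exact hA j k h
    · rintro j' hj
      cases hj
  obtain ⟨w⟩ := hconn.preconnected (Sum.inr ⟨0, hm⟩) (Sum.inl i)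
  have hwalk : ∀ s t, N.graph.Walk s t → P s → P t := by
    intro s t w
    induction w with
    | nil => exact id
    | cons h _ ih => exact fun hs => ih (hstep _ _ h hs)
  exact hwalk _ _ w (fun i hi => by cases hi) i rfl

theorem continuous_gX (l : Fin n × Fin n) :
    Continuous fun p : PosVec n × PosMat n => gX l p.2 := by
  unfold gX
  fun_prop

theorem continuous_gA (N : Network n m) (l : Fin n × Fin m) :
    Continuous fun p : PosVec n × PosMat n => N.gA l p.1 p.2 := by
  unfold Network.gA
  fun_prop

theorem continuous_objective (xhat : PosVec n) : Continuous (objective xhat) := by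
  have : objective xhat = fun p => trace p.2 - 2 * (xhat.ofLp ⬝ᵥ p.1.ofLp)
      + xhat.ofLp ⬝ᵥ xhat.ofLp := funext fun p => objective_eq xhat p.1 p.2
  rw [this]
  fun_prop

theorem isClosed_upperSet (N : Network n m) (cX : Fin n × Fin n → ℝ) (cA : Fin n × Fin m → ℝ) :
    IsClosed (N.upperSet cX cA) := by
  have : N.upperSet cX cA = liftedDomain n ∩ ((⋂ l ∈ N.Nx, {p | gX l p.2 ≤ cX l}) ∩
      ⋂ l ∈ N.Na, {p | N.gA l p.1 p.2 ≤ cA l}) := by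
    ext p
    simp only [Network.upperSet, Set.mem_inter_iff, Set.mem_iInter, Set.mem_ofPred_eq]
  rw [this]
  exact isClosed_liftedDomain.inter <|
    (isClosed_biInter fun l _ => isClosed_le (continuous_gX l) continuous_const).inter
      (isClosed_biInter fun l _ => isClosed_le (continuous_gA N l) continuous_const)

theorem isCompact_upperSet (N : Network n m) (hm : 0 < m) (hconn : N.graph.Connected)
    (cX : Fin n × Fin n → ℝ) (cA : Fin n × Fin m → ℝ) : IsCompact (N.upperSet cX cA) := by
  choose B hB using exists_diag_bound N hm hconn cX cA
  have hdiag : ∀ p ∈ N.upperSet cX cA, ∀ i, p.2 i i ≤ B i.1 := by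
    rintro p hp ⟨i, c⟩
    have h0 := (sq_nonneg _).trans (sq_le_diag hp.1 (i, 0))
    have h1 := (sq_nonneg _).trans (sq_le_diag hp.1 (i, 1))
    have := hB i p hp
    fin_cases c <;> simp only [Fin.zero_eta, Fin.mk_one] <;> linarith
  -- Diagonal bounds suffice: `y_i² ≤ Δ_ii` controls `y`, and `2|Δ_ij| ≤ Δ_ii + Δ_jj` controls the
  -- remaining entries.
  have hbox : IsCompact (Metric.closedBall (0 : PosVec n) √(∑ i : Fin n × Fin 2, B i.1) ×ˢ
      (Set.univ.pi fun i => Set.univ.pi fun j => Set.Icc (-(B i.1 + B j.1)) (B i.1 + B j.1) :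
        Set (PosMat n))) :=
    (isCompact_closedBall _ _).prod
      (isCompact_univ_pi fun i => isCompact_univ_pi fun j => isCompact_Icc)
  refine hbox.of_isClosed_subset (isClosed_upperSet N cX cA) fun p hp => ⟨?_, ?_⟩
  · rw [mem_closedBall_zero_iff]
    apply Real.le_sqrt_of_sq_le
    rw [EuclideanSpace.real_norm_sq_eq]
    exact Finset.sum_le_sum fun i _ => (sq_le_diag hp.1 i).trans (hdiag p hp i)
  · intro i _ j _
    have hi := hdiag p hp i
    have hj := hdiag p hp j
    have hi0 := (sq_nonneg _).trans (sq_le_diag hp.1 i)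
    have hj0 := (sq_nonneg _).trans (sq_le_diag hp.1 j)
    have h1 := quadratic_entries_nonneg hp.1 1 1 i j
    have h2 := quadratic_entries_nonneg hp.1 1 (-1) i j
    constructor <;> linarith

theorem isClosed_liftedConstraints (N : Network n m) :
    IsClosed {p : PosVec n × PosMat n | N.LiftedConstraints p.1 p.2} := by
  have : {p : PosVec n × PosMat n | N.LiftedConstraints p.1 p.2} =
      (⋂ l ∈ N.Nx, {p | N.lowX l ^ 2 ≤ gX l p.2} ∩ {p | gX l p.2 ≤ N.upX l ^ 2}) ∩
      ⋂ l ∈ N.Na, {p | N.lowA l ^ 2 ≤ N.gA l p.1 p.2} ∩ {p | N.gA l p.1 p.2 ≤ N.upA l ^ 2} := by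
    ext p
    simp [Network.LiftedConstraints]
  rw [this]
  exact (isClosed_biInter fun l _ => (isClosed_le continuous_const (continuous_gX l)).inter
    (isClosed_le (continuous_gX l) continuous_const)).inter
    (isClosed_biInter fun l _ => (isClosed_le continuous_const (continuous_gA N l)).inter
    (isClosed_le (continuous_gA N l) continuous_const))

theorem isCompact_setQ (N : Network n m) (hm : 0 < m) (hconn : N.graph.Connected) :
    IsCompact N.setQ := by
  refine (isCompact_upperSet N hm hconn (fun l => N.upX l ^ 2) (fun l => N.upA l ^ 2)
    ).of_isClosed_subset ((isClosed_liftedConstraints N).inter isClosed_liftedDomain) fun p hp => ?_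
  exact ⟨hp.2, fun l hl => (hp.1.1 l hl).2, fun l hl => (hp.1.2 l hl).2⟩

theorem setG_subset_setQ (N : Network n m) : N.setG ⊆ N.setQ := by
  rintro ⟨y, Δ⟩ ⟨h, rfl : Δ = outer y⟩
  exact ⟨h, outer_mem_liftedDomain y⟩

theorem isCompact_setG (N : Network n m) (hm : 0 < m) (hconn : N.graph.Connected) :
    IsCompact N.setG := by
  refine (isCompact_setQ N hm hconn).of_isClosed_subset
    ((isClosed_liftedConstraints N).inter (isClosed_eq continuous_snd ?_)) (setG_subset_setQ N)
  unfold outer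
  fun_prop

/-! ### Rank-one lifts: `G` and `C`. -/

theorem gX_outer (l : Fin n × Fin n) (y : PosVec n) :
    gX l (outer y) = ‖sensorPos y l.1 - sensorPos y l.2‖ ^ 2 := by
  rw [gX_eq_entries, EuclideanSpace.real_norm_sq_eq]
  simp [outer, vecMulVec_apply, sensorPos]
  ring

theorem gA_outer (N : Network n m) (l : Fin n × Fin m) (y : PosVec n) :
    N.gA l y (outer y) = ‖sensorPos y l.1 - N.anchor l.2‖ ^ 2 := by
  rw [gA_eq_entries, EuclideanSpace.real_norm_sq_eq]
  simp [outer, vecMulVec_apply, sensorPos]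
  ring

theorem liftedConstraints_outer_iff (N : Network n m) (y : PosVec n) :
    N.LiftedConstraints y (outer y) ↔ y ∈ N.setC := by
  simp only [Network.LiftedConstraints, gX_outer, gA_outer, Network.setC, Set.mem_ofPred_eq]

theorem objective_image_setG (N : Network n m) (xhat : PosVec n) :
    objective xhat '' N.setG = (fun y => ‖xhat - y‖ ^ 2) '' N.setC := by
  ext r
  constructor
  · rintro ⟨⟨y, Δ⟩, ⟨h, rfl : Δ = outer y⟩, rfl⟩
    exact ⟨y, (liftedConstraints_outer_iff N y).mp h, (objective_outer xhat y).symm⟩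
  · rintro ⟨y, h, rfl⟩
    exact ⟨(y, outer y), ⟨(liftedConstraints_outer_iff N y).mpr h, rfl⟩, objective_outer xhat y⟩

theorem sq_bounds_of_measurement {d z υ γ : ℝ} (hd : 0 ≤ d) (hz : z = d + υ) (hυ : |υ| ≤ γ) :
    max (z - γ) 0 ^ 2 ≤ d ^ 2 ∧ d ^ 2 ≤ (z + γ) ^ 2 := by
  have := abs_le.mp hυ
  exact ⟨pow_le_pow_left₀ (le_max_right _ _) (max_le (by linarith) hd) 2,
    pow_le_pow_left₀ hd (by linarith) 2⟩

theorem mem_setC_of_explains {N : Network n m} {x : PosVec n} {υx : Fin n × Fin n → ℝ}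
    {υa : Fin n × Fin m → ℝ} (hx : N.Explains x υx υa) : x ∈ N.setC :=
  ⟨fun l hl => sq_bounds_of_measurement (norm_nonneg _) (hx.1 l hl).1 (hx.1 l hl).2,
    fun l hl => sq_bounds_of_measurement (norm_nonneg _) (hx.2 l hl).1 (hx.2 l hl).2⟩

/-! ### Strong duality. -/

/-- The value and constraint functions of the concave program `max Tr Δ - ‖y‖²` over `Q`, the value
being measured relative to `c`. Off the links the constraint functions vanish. -/
def Network.programFun (N : Network n m) (c : ℝ) :
    Unit ⊕ (Fin n × Fin n) ⊕ (Fin n × Fin n) ⊕ (Fin n × Fin m) ⊕ (Fin n × Fin m) →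
      PosVec n × PosMat n → ℝ
  | .inl _, p => trace p.2 - p.1.ofLp ⬝ᵥ p.1.ofLp - c
  | .inr (.inl l), p => if l ∈ N.Nx then gX l p.2 - N.lowX l ^ 2 else 0
  | .inr (.inr (.inl l)), p => if l ∈ N.Nx then N.upX l ^ 2 - gX l p.2 else 0
  | .inr (.inr (.inr (.inl l))), p => if l ∈ N.Na then N.gA l p.1 p.2 - N.lowA l ^ 2 else 0
  | .inr (.inr (.inr (.inr l))), p => if l ∈ N.Na then N.upA l ^ 2 - N.gA l p.1 p.2 else 0

theorem gX_convexCombo (l : Fin n × Fin n) (p q : PosVec n × PosMat n) (a b : ℝ) :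
    gX l (a • p + b • q).2 = a * gX l p.2 + b * gX l q.2 := by
  rw [gX_eq_entries, gX_eq_entries, gX_eq_entries]
  simp
  ring

theorem gA_convexCombo (N : Network n m) (l : Fin n × Fin m) (p q : PosVec n × PosMat n)
    {a b : ℝ} (hab : a + b = 1) :
    N.gA l (a • p + b • q).1 (a • p + b • q).2 = a * N.gA l p.1 p.2 + b * N.gA l q.1 q.2 := by
  obtain rfl : b = 1 - a := by linarith
  rw [gA_eq_entries, gA_eq_entries, gA_eq_entries]
  simp
  ring

theorem concaveOn_programFun (N : Network n m) (c : ℝ) (i) :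
    ConcaveOn ℝ (liftedDomain n) (N.programFun c i) := by
  refine ⟨convex_liftedDomain, fun p hp q hq a b ha hb hab => ?_⟩
  have hb' : b = 1 - a := by linarith
  rcases i with _ | l | l | l | l <;> simp only [Network.programFun, smul_eq_mul]
  · have h : ‖a • p.1 + b • q.1‖ ^ 2 ≤ a * ‖p.1‖ ^ 2 + b * ‖q.1‖ ^ 2 := by
      simpa using (convexOn_univ_norm (E := PosVec n).pow (fun _ _ => norm_nonneg _) 2).2
        (Set.mem_univ p.1) (Set.mem_univ q.1) ha hb hab
    simp only [dotProduct_self_eq_norm_sq, Prod.fst_add, Prod.snd_add, Prod.smul_fst,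
      Prod.smul_snd, trace_add, trace_smul, smul_eq_mul]
    subst hb'
    linarith
  · split_ifs
    · rw [gX_convexCombo]; subst hb'; linarith
    · simp
  · split_ifs
    · rw [gX_convexCombo]; subst hb'; linarith
    · simp
  · split_ifs
    · rw [gA_convexCombo N l p q hab]; subst hb'; linarith
    · simp
  · split_ifs
    · rw [gA_convexCombo N l p q hab]; subst hb'; linarith
    · simp

theorem continuous_programFun (N : Network n m) (c : ℝ) (i) : Continuous (N.programFun c i) := by
  rcases i with _ | l | l | l | l <;> unfold Network.programFun <;> dsimp only
  · fun_prop
  · split_ifs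
    exacts [(continuous_gX l).sub continuous_const, continuous_const]
  · split_ifs
    exacts [continuous_const.sub (continuous_gX l), continuous_const]
  · split_ifs
    exacts [(continuous_gA N l).sub continuous_const, continuous_const]
  · split_ifs
    exacts [continuous_const.sub (continuous_gA N l), continuous_const]

/-- The thresholds on the upper-bound slacks place the set inside some `upperSet`, which is why that
set allows arbitrary bounds. -/
theorem isCompact_superlevel_programFun (N : Network n m) (hm : 0 < m) (hconn : N.graph.Connected)
    (c : ℝ) (d : Unit ⊕ (Fin n × Fin n) ⊕ (Fin n × Fin n) ⊕ (Fin n × Fin m) ⊕ (Fin n × Fin m) → ℝ) :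
    IsCompact {p | p ∈ liftedDomain n ∧ ∀ i, d i ≤ N.programFun c i p} := by
  refine (isCompact_upperSet N hm hconn (fun l => N.upX l ^ 2 - d (.inr (.inr (.inl l))))
    (fun l => N.upA l ^ 2 - d (.inr (.inr (.inr (.inr l)))))).of_isClosed_subset ?_ ?_
  · have : {p | p ∈ liftedDomain n ∧ ∀ i, d i ≤ N.programFun c i p}
        = liftedDomain n ∩ ⋂ i, {p | d i ≤ N.programFun c i p} := by
      ext p
      simp only [Set.mem_inter_iff, Set.mem_iInter, Set.mem_ofPred_eq]
    rw [this]
    exact isClosed_liftedDomain.inter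
      (isClosed_iInter fun i => isClosed_le continuous_const (continuous_programFun N c i))
  · rintro p ⟨hp, h⟩
    refine ⟨hp, fun l hl => ?_, fun l hl => ?_⟩
    · have := h (.inr (.inr (.inl l)))
      simp only [Network.programFun, hl, if_true] at this
      linarith
    · have := h (.inr (.inr (.inr (.inr l))))
      simp only [Network.programFun, hl, if_true] at this
      linarith

theorem lagrangeMat_isHermitian (N : Network n m) (v : SDPVars n m) :
    (N.lagrangeMat v).IsHermitian := by
  have hs : ∀ a : Fin n × Fin 2 → ℝ, (vecMulVec a a)ᵀ = vecMulVec a a := fun a =>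
    transpose_vecMulVec a a
  simp [IsHermitian, Network.lagrangeMat, conjTranspose_eq_transpose_of_trivial, transpose_sum,
    matX, matA, hs]

/-- A bound of the Lagrangian on all pairs `Δ ⪰ y yᵀ` is certified by a feasible point of the
semidefinite program. -/
theorem exists_feasible_of_lagrangian_le (N : Network n m) (v : SDPVars n m)
    (hx : ∀ l ∈ N.Nx, 0 ≤ v.α l ∧ 0 ≤ v.β l) (ha : ∀ l ∈ N.Na, 0 ≤ v.ω l ∧ 0 ≤ v.φ l) (c : ℝ)
    (hc : ∀ p ∈ liftedDomain n,
      trace p.2 - p.1.ofLp ⬝ᵥ p.1.ofLp + N.weightedSlack v p.1 p.2 ≤ c) :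
    ∃ w : SDPVars n m, N.SDPFeasible w ∧ w.t + N.h w = c := by
  have hlam : (N.lagrangeMat v - 1).PosSemidef := by
    refine PosSemidef.of_dotProduct_mulVec_nonneg
      ((lagrangeMat_isHermitian N v).sub isHermitian_one) fun z => ?_
    rw [star_trivial]
    by_contra! hneg
    rw [sub_mulVec, dotProduct_sub, one_mulVec] at hneg
    set r := z ⬝ᵥ z - z ⬝ᵥ N.lagrangeMat v *ᵥ z with hr
    have hr0 : 0 < r := by linarith
    -- At `(0, s z zᵀ)` the Lagrangian equals `h + s r`, and this `s` makes it exceed `c`.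
    set s := (|c - N.h v| + 1) / r
    have hs : 0 ≤ s := by positivity
    have hsr : s * r = |c - N.h v| + 1 := div_mul_cancel₀ _ hr0.ne'
    have hmem : ((0 : PosVec n), s • vecMulVec z z) ∈ liftedDomain n := by
      have := (posSemidef_vecMulVec_self_star z).smul hs
      simpa [liftedDomain, outer] using this
    have := hc _ hmem
    rw [weightedSlack_eq] at this
    simp only [trace_smul, trace_vecMulVec, Matrix.mul_smul, smul_eq_mul,
      trace_mul_comm (N.lagrangeMat v), trace_vecMulVec_mul, WithLp.ofLp_zero,
      dotProduct_zero] at this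
    have h2 : s * r = s * (z ⬝ᵥ z) - s * (z ⬝ᵥ N.lagrangeMat v *ᵥ z) := by rw [hr]; ring
    linarith [le_abs_self (c - N.h v)]
  refine ⟨{ v with lam := N.lagrangeMat v - 1, t := c - N.h v }, ⟨hx, ha, hlam, ?_, ?_⟩, ?_⟩
  · change 1 + (N.lagrangeMat v - 1) = N.lagrangeMat v
    abel
  · change (fromBlocks (1 + (N.lagrangeMat v - 1)) (replicateCol Unit (N.f v))
      (replicateRow Unit (N.f v)) (of fun _ _ : Unit => c - N.h v)).PosSemidef
    have hadd : 1 + (N.lagrangeMat v - 1) = N.lagrangeMat v := by abel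
    have hL : (N.lagrangeMat v).PosSemidef := hadd ▸ PosSemidef.one.add hlam
    rw [hadd]
    refine fromBlocks_posSemidef hL fun z => ?_
    -- On rank-one pairs `Tr Δ - ‖y‖²` vanishes, so the bound `c` becomes the inhomogeneous
    -- quadratic inequality behind the Schur block.
    have := hc _ (outer_mem_liftedDomain (WithLp.toLp 2 z))
    rw [weightedSlack_eq, trace_mul_comm] at this
    simp only [outer, trace_vecMulVec, trace_vecMulVec_mul] at this
    linarith
  · change c - N.h v + N.h v = c
    ring

/-- Strong duality: some point of `Q` attains the optimal value of the semidefinite program. -/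
theorem exists_mem_setQ_value_le (N : Network n m) (hm : 0 < m) (hconn : N.graph.Connected)
    (hne : N.setQ.Nonempty) {v : SDPVars n m} (hv : N.IsSDPSolution v) :
    ∃ p ∈ N.setQ, v.t + N.h v ≤ trace p.2 - p.1.ofLp ⬝ᵥ p.1.ofLp := by
  by_contra! hcon
  set c := v.t + N.h v
  obtain ⟨μ, hμ, δ, hδ, hsum⟩ := exists_weights_of_forall_exists_neg (concaveOn_programFun N c)
    convex_liftedDomain (isCompact_superlevel_programFun N hm hconn c) (fun p hp => by
      by_contra! h
      have hcons : N.LiftedConstraints p.1 p.2 := by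
        refine ⟨fun l hl => ⟨?_, ?_⟩, fun l hl => ⟨?_, ?_⟩⟩
        · simpa [Network.programFun, hl] using h (.inr (.inl l))
        · simpa [Network.programFun, hl] using h (.inr (.inr (.inl l)))
        · simpa [Network.programFun, hl] using h (.inr (.inr (.inr (.inl l))))
        · simpa [Network.programFun, hl] using h (.inr (.inr (.inr (.inr l))))
      have := hcon p ⟨hcons, hp⟩
      have := h (.inl ())
      simp only [Network.programFun] at this
      linarith)
  set μ₀ := μ (.inl ())
  -- `lam` and `t` are placeholders: the weighted slack does not involve them.
  let w (s : ℝ) : SDPVars n m :=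
    { α := fun l => s * μ (.inr (.inl l))
      β := fun l => s * μ (.inr (.inr (.inl l)))
      ω := fun l => s * μ (.inr (.inr (.inr (.inl l))))
      φ := fun l => s * μ (.inr (.inr (.inr (.inr l))))
      lam := 0
      t := 0 }
  have hw : ∀ s, 0 ≤ s → (∀ l ∈ N.Nx, 0 ≤ (w s).α l ∧ 0 ≤ (w s).β l) ∧
      ∀ l ∈ N.Na, 0 ≤ (w s).ω l ∧ 0 ≤ (w s).φ l := fun s hs =>
    ⟨fun l _ => ⟨mul_nonneg hs (hμ _), mul_nonneg hs (hμ _)⟩,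
      fun l _ => ⟨mul_nonneg hs (hμ _), mul_nonneg hs (hμ _)⟩⟩
  have hscale : ∀ s y Δ, N.weightedSlack (w s) y Δ = s * N.weightedSlack (w 1) y Δ := by
    intro s y Δ
    simp only [Network.weightedSlack, w, mul_add, Finset.mul_sum, one_mul, mul_assoc]
  have hexp : ∀ p ∈ liftedDomain n, μ₀ * (trace p.2 - p.1.ofLp ⬝ᵥ p.1.ofLp - c)
      + N.weightedSlack (w 1) p.1 p.2 ≤ -δ := by
    intro p hp
    refine le_trans (le_of_eq ?_) (hsum p hp)
    simp [Fintype.sum_sum_type, Network.programFun, Network.weightedSlack, w, μ₀, add_assoc]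
  rcases (hμ (.inl ())).eq_or_lt with h0 | h0
  -- If the value has weight zero, the constraint slacks alone would sum to at most `-δ` at a point
  -- of `Q`, where they are nonnegative.
  · obtain ⟨p, hp⟩ := hne
    have h1 := hexp p hp.2
    have h2 := weightedSlack_nonneg (hw 1 zero_le_one).1 (hw 1 zero_le_one).2 hp.1
    rw [show μ₀ = 0 from h0.symm] at h1
    linarith
  · change 0 < μ₀ at h0
    have hs : 0 ≤ μ₀⁻¹ := inv_nonneg.mpr h0.le
    -- Normalizing the weight of the value to `1` bounds the Lagrangian by `c - δ / μ₀`, hence gives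
    -- a feasible point below the optimal value `c`.
    obtain ⟨u, hu, huc⟩ := exists_feasible_of_lagrangian_le N (w μ₀⁻¹) (hw _ hs).1 (hw _ hs).2
      (c - μ₀⁻¹ * δ) (fun p hp => by
        have := mul_le_mul_of_nonneg_left (hexp p hp) hs
        rw [mul_add, ← mul_assoc, inv_mul_cancel₀ h0.ne', one_mul, ← hscale] at this
        linarith)
    have h1 := hv.2 u hu
    have h2 : 0 < μ₀⁻¹ * δ := by positivity
    linarith

end RangeLocalization

/-! ### The theorem. -/

open RangeLocalization in
theorem mainTheorem2 {n m : ℕ} (N : Network n m) (hm : 0 < m) (hconn : N.graph.Connected)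
    (x : PosVec n) (υx : Fin n × Fin n → ℝ) (υa : Fin n × Fin m → ℝ)
    (hx : N.Explains x υx υa)
    (v : SDPVars n m) (hv : N.IsSDPSolution v) :
    (∀ xhat : PosVec n, IsGreatest (objective xhat '' N.setQ) (N.relaxedWorst xhat)) ∧
    ∃ M : ℝ,
      IsGreatest ((fun y : PosVec n => ‖N.xEst v - y‖ ^ 2) '' N.setC) M ∧
      IsGreatest (objective (N.xEst v) '' N.setG) M ∧
      ‖N.xEst v - x‖ ^ 2 ≤ M ∧
      M ≤ N.relaxedWorst (N.xEst v) ∧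
      IsLeast (Set.range N.relaxedWorst) (N.relaxedWorst (N.xEst v)) := by
  have hxC : x ∈ N.setC := mem_setC_of_explains hx
  have hxG : (x, outer x) ∈ N.setG := ⟨(liftedConstraints_outer_iff N x).mpr hxC, rfl⟩
  have hneQ : N.setQ.Nonempty := ⟨_, setG_subset_setQ N hxG⟩
  have hQ : ∀ xhat : PosVec n, IsGreatest (objective xhat '' N.setQ) (N.relaxedWorst xhat) :=
    fun xhat => ((isCompact_setQ N hm hconn).image (continuous_objective xhat)).isGreatest_sSup
      (hneQ.image _)
  obtain ⟨M, hM⟩ := ((isCompact_setG N hm hconn).image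
    (continuous_objective (N.xEst v))).exists_isGreatest ⟨_, Set.mem_image_of_mem _ hxG⟩
  have hMC := hM
  rw [objective_image_setG] at hMC
  refine ⟨hQ, M, hMC, hM, hMC.2 ⟨x, hxC, rfl⟩, ?_, ⟨_, rfl⟩, ?_⟩
  · exact (hQ _).2 (Set.image_mono (setG_subset_setQ N) hM.1)
  · rintro _ ⟨xhat, rfl⟩
    -- The point `(y, Δ)` does not depend on `xhat`: it is the dual side of the saddle point, and `t
    -- + h` is the common value.
    obtain ⟨⟨y, Δ⟩, hp, hval⟩ := exists_mem_setQ_value_le N hm hconn hneQ hv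
    obtain ⟨q, hq, hqv⟩ := (hQ (N.xEst v)).1
    calc N.relaxedWorst (N.xEst v) = objective (N.xEst v) q := hqv.symm
      _ ≤ v.t + N.h v := mem_setQ_objective_le hv.1 hq
      _ ≤ trace Δ - y.ofLp ⬝ᵥ y.ofLp := hval
      _ ≤ objective xhat (y, Δ) := objective_ge xhat y Δ
      _ ≤ N.relaxedWorst xhat := (hQ xhat).2 ⟨_, hp, rfl⟩
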